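/- All graphs are finite and simple, and $n\ge 0$ is an integer. For a graph $G$ with $n$ vertices, $\mathrm{Part}(G)\vdash n$ is the partition formed by the numbers of vertices of the connected components of $G$; $\ell(\lambda)$ is the number of parts of a partition $\lambda$; $X_G=\sum_\kappa\prod_{v\in V(G)}x_{\kappa(v)}$ is the chromatic symmetric function (sum over all proper colorings $\kappa:V(G)\to\mathbb{Z}^+$); and $$U_G(x,y)=\sum_{A\subseteq E(G)}\Big(\prod_{i=1}^{|V(G)|}x_i^{c_i(A)}\Big)(y-1)^{|A|-r(A)}$$ is the $U$-polynomial, where $c_i(A)$ is the number of components with $i$ vertices of the spanning subgraph $(V(G),A)$ and $r(A)=|V(G)|-\sum_i c_i(A)$. For a forest all exponents of $y-1$ are $0$. Write $[\lambda]U_G\in\mathbb{Q}[y]$ for the coefficient of $x_{\lambda_1}\cdots x_{\lambda_\ell}$ in $U_G$. A forest-basis is a set $B=\{X_{G_\lambda}\mid\lambda\vdash n\}$, where for each $\lambda\vdash n$ a forest $G_\lambda$ with $n$ vertices and $\mathrm{Part}(G_\lambda)=\lambda$ has been chosen. Write $X_G=\sum_{\lambda\vdash n}[\lambda]X_{G,B}\,X_{G_\lambda}$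 with $[\lambda]X_{G,B}\in\mathbb{Q}$, and for $j\ge0$ put $$X^j_{G,B}=\sum_{\ell(\lambda)\le\ell(\mathrm{Part}(G))+j}[\lambda]X_{G,B}\,X_{G_\lambda}.$$ The corner number of a forest $F$ with respect to $B$ is the integer $k\ge1$ with $X^{k-1}_{F,B}=X_{G_{\mathrm{Part}(F)}}$ but $X^{k}_{F,B}\ne X_{G_{\mathrm{Part}(F)}}$; it is $\infty$ if $X^j_{F,B}=X_{G_{\mathrm{Part}(F)}}$ for all $j\ge 0$. **Theorem.** Let $F_1$ and $F_2$ be forests with $n$ vertices such that $\mathrm{Part}(F_1)=\mathrm{Part}(F_2)=\mu$, and let $B$ be a forest-basis with $X_{F_2}\in B$. Then there is exactly one family of rational coefficients $([\lambda]X_{F_1,B})_{\lambda\vdash n}$ expressing $X_{F_1}$ in $B$, and $F_1$ has exactly one corner number $k\in\{1,2,\ldots\}\cup\{\infty\}$ with respect to $B$. For every $\lambda\vdash n$ with $\lambda\ne\mu$ and $\ell(\lambda)\le\ell(\mu)+k$ (in particular, whenever $\ell(\lambda)\le k$), $$[\lambda]X_{F_1,B}=[\lambda]U_{F_1}-[\lambda]U_{F_2}.$$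 Moreover, $[\mu]X_{F_1,B}=1$ and $[\mu]U_{F_1}-[\mu]U_{F_2}=0$. -/

import Mathlib

namespace ForestCSF

noncomputable section

universe u

/-- The chromatic symmetric function `X_G = ∑_κ ∏_v x_{κ(v)}` (sum over all proper colorings
`κ : V → ℤ⁺`), a formal power series in `x_1, x_2, …`: the coefficient of the monomial `x^d` is
the number of proper colorings `κ` with `∏_v x_{κ(v)} = x^d`. -/
def csf {V : Type u} [Fintype V] (G : SimpleGraph V) : MvPowerSeries ℕ+ ℚ :=
  fun d => (Nat.card {κ : G.Coloring ℕ+ // ∑ v, Finsupp.single (κ v) 1 = d} : ℚ)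

/-- The sets counted in `csf` are finite. -/
theorem finite_colorings {V : Type u} [Fintype V] (G : SimpleGraph V) (d : ℕ+ →₀ ℕ) :
    Finite {κ : G.Coloring ℕ+ // ∑ v, Finsupp.single (κ v) 1 = d} := by
  have key : ∀ κ : {κ : G.Coloring ℕ+ // ∑ v, Finsupp.single (κ v) 1 = d}, ∀ v,
      κ.1 v ∈ d.support := by
    rintro ⟨κ, hκ⟩ v
    rw [Finsupp.mem_support_iff]
    change d (κ v) ≠ 0
    subst hκ
    rw [Finsupp.finsetSum_apply]
    intro h
    have h2 := (Finset.sum_eq_zero_iff.mp h) v (Finset.mem_univ v)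
    simp at h2
  refine Finite.of_injective (β := V → d.support) (fun κ v => ⟨κ.1 v, key κ v⟩) ?_
  intro κ κ' h
  apply Subtype.ext
  apply RelHom.ext
  intro v
  exact congrArg Subtype.val (congrFun h v)

open Classical in
/-- The multiset of the numbers of vertices of the connected components of `G`. -/
def componentSizes {V : Type u} [Fintype V] (G : SimpleGraph V) : Multiset ℕ :=
  (Finset.univ : Finset G.ConnectedComponent).val.map fun c => c.supp.ncard

theorem componentSizes_pos {V : Type u} [Fintype V] (G : SimpleGraph V) {i : ℕ}
    (hi : i ∈ componentSizes G) : 0 < i := by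
  classical
  obtain ⟨c, -, rfl⟩ := Multiset.mem_map.mp hi
  exact (Set.ncard_pos (Set.toFinite _)).mpr c.nonempty_supp

theorem componentSizes_sum {V : Type u} [Fintype V] (G : SimpleGraph V) :
    (componentSizes G).sum = Fintype.card V := by
  classical
  have h : (componentSizes G).sum
      = ∑ c : G.ConnectedComponent, (Finset.univ.filter
          fun v => G.connectedComponentMk v = c).card := by
    refine Finset.sum_congr rfl fun c _ => ?_
    rw [← Set.ncard_coe_finset]
    congr 1
    ext v
    simp
  rw [h, ← Finset.card_univ]
  exact (Finset.card_eq_sum_card_fiberwise fun v _ => Finset.mem_coe.mpr (Finset.mem_univ _)).symm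

/-- `Part(G)`: the partition of `n = |V|` given by the component sizes of `G`. -/
def part {n : ℕ} {V : Type u} [Fintype V] (G : SimpleGraph V) (hV : Fintype.card V = n) :
    n.Partition where
  parts := componentSizes G
  parts_pos := componentSizes_pos G
  parts_sum := (componentSizes_sum G).trans hV

/-- The length `ℓ(lam)` of a partition. -/
def length {n : ℕ} (lam : n.Partition) : ℕ := Multiset.card lam.parts

open Classical in
/-- The `U`-polynomial of Noble and Welsh,
`U_G = ∑_{A ⊆ E(G)} (∏_{i=1}^{|V|} x_i^{c_i(A)}) (y - 1)^{|A| - r(A)}`, where `c_i(A)` is the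
number of components with `i` vertices of the spanning subgraph `(V, A)` and `r(A)` is `|V|` minus
the number of components of `(V, A)`.  It is a polynomial in the `x_i` over `ℚ[y]`
(`Polynomial.X` is `y`).  Both subtractions in the exponent are of a smaller number from a larger
one. -/
def uPoly {V : Type u} [Fintype V] (G : SimpleGraph V) : MvPolynomial ℕ (Polynomial ℚ) :=
  ∑ A ∈ G.edgeFinset.powerset,
    MvPolynomial.C ((Polynomial.X - 1) ^ (A.card - (Fintype.card V -
      Multiset.card (componentSizes (SimpleGraph.fromEdgeSet (A : Set (Sym2 V))))))) *
    ∏ i ∈ Finset.Icc 1 (Fintype.card V), MvPolynomial.X i ^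
      (componentSizes (SimpleGraph.fromEdgeSet (A : Set (Sym2 V)))).count i

/-- `[lam] U_G`: the coefficient in `U_G` of `x_lam = x_{lam_1} ⋯ x_{lam_l}`, a polynomial
in `y`. -/
def uCoeff {n : ℕ} {V : Type u} [Fintype V] (lam : n.Partition) (G : SimpleGraph V) :
    Polynomial ℚ :=
  (uPoly G).coeff (Multiset.toFinsupp lam.parts)

/-- The data of a chromatic-basis: a graph `G_lam` on `n` vertices with `Part(G_lam) = lam` for
every partition `lam` of `n`. -/
structure ChromaticBasis (n : ℕ) where
  graph : n.Partition → SimpleGraph (Fin n)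
  part_graph : ∀ lam, part (graph lam) (Fintype.card_fin n) = lam

namespace ChromaticBasis

variable {n : ℕ} (B : ChromaticBasis n)

/-- A forest-basis is a chromatic-basis all of whose graphs are forests. -/
def IsForestBasis : Prop := ∀ lam, (B.graph lam).IsAcyclic

/-- The chromatic-basis as a set, `{X_{G_lam} | lam ⊢ n}`. -/
def toSet : Set (MvPowerSeries ℕ+ ℚ) := Set.range fun lam => csf (B.graph lam)

/-- `c` is a family of coefficients expressing `X_G` in `B`. -/
def IsExpansion {V : Type u} [Fintype V] (G : SimpleGraph V) (c : n.Partition → ℚ) : Prop :=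
  csf G = ∑ lam, c lam • csf (B.graph lam)

open Classical in
/-- `[lam] X_{G,B}`: the coefficient of `X_{G_lam}` in the expression of `X_G` in `B` (zero if
there is no such expression). -/
def coeff {V : Type u} [Fintype V] (G : SimpleGraph V) (lam : n.Partition) : ℚ :=
  if h : ∃ c, B.IsExpansion G c then h.choose lam else 0

/-- `X^k_{G,B}`: the part of the expression of `X_G` in `B` that comes from the partitions of
length at most `ℓ(Part(G)) + k`. -/
def truncation {V : Type u} [Fintype V] (G : SimpleGraph V) (hV : Fintype.card V = n) (k : ℕ) :
    MvPowerSeries ℕ+ ℚ :=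
  ∑ lam : n.Partition with length lam ≤ length (part G hV) + k,
    B.coeff G lam • csf (B.graph lam)

/-- `k` is the corner number of the forest `F` with respect to `B`: with `F'` the member of the
basis satisfying `Part(F') = Part(F)`, one has `X^{k-1}_{F,B} = X_{F'}` but `X^k_{F,B} ≠ X_{F'}`.
The corner number is `∞` when all the `X^j_{F,B}` agree with `X_{F'}`. -/
def IsCornerNumber {V : Type u} [Fintype V] (F : SimpleGraph V) (hV : Fintype.card V = n)
    (k : ℕ∞) : Prop :=
  (∃ j : ℕ, k = ((j + 1 : ℕ) : ℕ∞) ∧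
    B.truncation F hV j = csf (B.graph (part F hV)) ∧
    B.truncation F hV (j + 1) ≠ csf (B.graph (part F hV))) ∨
  (k = ⊤ ∧ ∀ j : ℕ, B.truncation F hV j = csf (B.graph (part F hV)))

end ChromaticBasis

end

end ForestCSF

/-!
Inclusion-exclusion over edge sets writes `X_G` in power sums, and grouping the terms by component
sizes gives the identity of Noble and Welsh: `x_i ↦ (-1)^(i-1) p_i`, `y ↦ 0` takes `U_G` to `X_G`.
The `p_lam` are linearly independent, so expanding `X_G` in a basis amounts to expanding the
coefficient vector of `U_G(x, 0)` in those of the basis graphs. Deleting edges from a forest `F`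
only lengthens the partition into components, so this vector has entry `1` at `Part(F)` and is
otherwise supported on longer partitions. Hence for a forest-basis the linear system is triangular
with respect to length and diagonal within each length. Below length `ℓ(μ) + k` the expansions of
`F₁` and `F₂` agree, so at the first length where they may differ the system is solved by the
difference of the two coefficient vectors.
-/

namespace ForestCSF

noncomputable section

section RankTriangular

open Matrix

/-- Triangularity of a square matrix with respect to a rank `r` on its indices: the diagonal
entries are nonzero, and any other nonzero entry `M i j` has `r i < r j`.  Distinct indices of equal
rank are therefore decoupled, which is stronger than block triangularity. -/
structure IsRankTriangular {ι β R : Type*} [Preorder β] [Zero R] (r : ι → β) (M : Matrix ι ι R) :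
    Prop where
  diag_ne_zero : ∀ i, M i i ≠ 0
  eq_or_lt : ∀ {i j}, M i j ≠ 0 → i = j ∨ r i < r j

namespace IsRankTriangular

variable {ι β R : Type*} [Fintype ι] [Preorder β] {r : ι → β}

theorem vecMul_apply [NonUnitalNonAssocSemiring R] {M : Matrix ι ι R} (hM : IsRankTriangular r M)
    {a : ι → R} {i : ι} (ha : ∀ j, r j < r i → a j = 0) : (a ᵥ* M) i = a i * M i i := by
  refine Finset.sum_eq_single i (fun j _ hji => ?_) fun hi => absurd (Finset.mem_univ i) hi
  by_cases hMji : M j i = 0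
  · exact mul_eq_zero_of_right _ hMji
  · exact mul_eq_zero_of_left (ha j ((hM.eq_or_lt hMji).resolve_left hji)) _

theorem eq_zero_of_vecMul_eq_zero [NonUnitalNonAssocSemiring R] [NoZeroDivisors R]
    {M : Matrix ι ι R} (hM : IsRankTriangular r M) {a : ι → R} {N : β}
    (ha : ∀ i, r i ≤ N → (a ᵥ* M) i = 0) {i : ι} (hi : r i ≤ N) : a i = 0 := by
  by_contra hai
  obtain ⟨j, ⟨hjN, haj⟩, hmin⟩ :=
    (Set.toFinite {j | r j ≤ N ∧ a j ≠ 0}).exists_minimalFor r _ ⟨i, hi, hai⟩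
  have hbelow : ∀ k, r k < r j → a k = 0 := fun k hkj => by
    by_contra hak
    exact hkj.not_ge (hmin ⟨hkj.le.trans hjN, hak⟩ hkj.le)
  have hprod : a j * M j j = 0 := by rw [← hM.vecMul_apply hbelow, ha j hjN]
  exact (mul_ne_zero haj (hM.diag_ne_zero j)) hprod

theorem vecMul_injective [NonUnitalNonAssocRing R] [NoZeroDivisors R] {M : Matrix ι ι R}
    (hM : IsRankTriangular r M) : Function.Injective fun a : ι → R => a ᵥ* M := by
  intro a b hab
  refine sub_eq_zero.mp (funext fun i => hM.eq_zero_of_vecMul_eq_zero (fun j _ => ?_) le_rfl)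
  rw [sub_vecMul, sub_eq_zero.mpr hab, Pi.zero_apply]

theorem vecMul_surjective [Field R] {M : Matrix ι ι R} (hM : IsRankTriangular r M) :
    Function.Surjective fun a : ι → R => a ᵥ* M :=
  LinearMap.injective_iff_surjective (f := M.vecMulLinear).mp hM.vecMul_injective

end IsRankTriangular

end RankTriangular

section PowerSum

open MvPowerSeries

variable {σ ι : Type*}

variable (σ) in
/-- The ways to place weights `a x`, one for each `x : ι`, on the elements of `σ` so that the total
weights form the exponent vector `d`. -/
abbrev Placement [Fintype ι] (a : ι → ℕ) (d : σ →₀ ℕ) : Type _ :=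
  {f : ι → σ // ∑ x, Finsupp.single (f x) (a x) = d}

theorem support_sum_single [Fintype ι] [DecidableEq σ] {a : ι → ℕ} (ha : ∀ x, 0 < a x)
    (f : ι → σ) : (∑ x, Finsupp.single (f x) (a x)).support = Finset.univ.image f := by
  ext i
  simp [Finsupp.finsetSum_apply, Finsupp.single_apply, (ha _).ne']

theorem finite_placement [Fintype ι] {a : ι → ℕ} (ha : ∀ x, 0 < a x) (d : σ →₀ ℕ) :
    Finite (Placement σ a d) := by
  classical
  have hmem : ∀ (f : Placement σ a d) (x : ι), f.1 x ∈ d.support := by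
    rintro ⟨f, rfl⟩ x
    rw [support_sum_single ha]
    exact Finset.mem_image_of_mem f (Finset.mem_univ x)
  refine Finite.of_injective (β := ι → d.support) (fun f x => ⟨f.1 x, hmem f x⟩) fun f g hfg => ?_
  exact Subtype.ext (funext fun x => congrArg Subtype.val (congrFun hfg x))

theorem map_support_sum_single [Fintype ι] {a : ι → ℕ} (ha : ∀ x, 0 < a x) {f : ι → σ}
    (hf : Function.Injective f) {d : σ →₀ ℕ} (hd : ∑ x, Finsupp.single (f x) (a x) = d) :
    d.support.val.map d = (Finset.univ : Finset ι).val.map a := by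
  classical
  subst hd
  rw [support_sum_single ha, Finset.image_val_of_injOn hf.injOn, Multiset.map_map]
  refine Multiset.map_congr rfl fun x _ => ?_
  simp [Finsupp.single_apply, hf.eq_iff]

/-- A placement either uses distinct elements, in which case the weights can be read off the
exponent vector, or it shrinks the support. -/
theorem Placement.map_support_eq_or_card_support_lt [Fintype ι] {a : ι → ℕ} (ha : ∀ x, 0 < a x)
    {d : σ →₀ ℕ} (f : Placement σ a d) :
    d.support.val.map d = (Finset.univ : Finset ι).val.map a ∨
      d.support.card < Fintype.card ι := by
  classical
  obtain ⟨f, rfl⟩ := f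
  by_cases hf : Function.Injective f
  · exact .inl (map_support_sum_single ha hf rfl)
  · right
    rw [support_sum_single ha]
    exact lt_of_le_of_ne Finset.card_image_le fun hcard =>
      hf fun x y hxy => Finset.card_image_iff.mp hcard (by simp) (by simp) hxy

variable (R : Type*) [CommSemiring R]

variable (σ) in
open Classical in
/-- The power sum `p_k = ∑_i x_i^k` in a possibly infinite set `σ` of variables.  Only `k > 0` is
meaningful: `powerSum σ R 0` is `1` when `σ` is nonempty. -/
def powerSum (k : ℕ) : MvPowerSeries σ R :=
  fun d => if ∃ i, d = Finsupp.single i k then 1 else 0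

variable (σ) in
/-- The product `p_m` of the power sums `p_k`, where `k` runs through the multiset `m`. -/
def powerSumProd (m : Multiset ℕ) : MvPowerSeries σ R :=
  (m.map (powerSum σ R)).prod

theorem coeff_prod_powerSum [Fintype ι] {a : ι → ℕ} (ha : ∀ x, 0 < a x) (d : σ →₀ ℕ) :
    coeff d (∏ x, powerSum σ R (a x)) = Nat.card (Placement σ a d) := by
  classical
  let placed : Finset (ι →₀ σ →₀ ℕ) :=
    {l ∈ Finset.univ.finsuppAntidiag d | ∀ x, ∃ i, l x = Finsupp.single i (a x)}
  have hmem (f : ι → σ) : Finsupp.equivFunOnFinite.symm (fun x => Finsupp.single (f x) (a x)) ∈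
      placed ↔ ∑ x, Finsupp.single (f x) (a x) = d := by
    simp only [placed, Finset.mem_filter, Finset.mem_finsuppAntidiag, Finset.subset_univ, and_true,
      Finsupp.equivFunOnFinite_symm_apply_apply]
    exact and_iff_left fun x => ⟨f x, rfl⟩
  have hcoeff : coeff d (∏ x, powerSum σ R (a x)) = placed.card := by
    rw [coeff_prod, ← Finset.sum_boole]
    refine Finset.sum_congr rfl fun l _ => ?_
    simp only [coeff_apply, powerSum, Finset.prod_ite_zero, Finset.prod_const_one,
      Finset.mem_univ, true_implies]
  rw [hcoeff, ← Nat.card_eq_finsetCard]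
  refine congrArg _ (Nat.card_eq_of_bijective
    (fun f : Placement σ a d => (⟨_, (hmem f.1).mpr f.2⟩ : placed)) ⟨fun f g hfg => ?_, ?_⟩).symm
  · refine Subtype.ext (funext fun x => ?_)
    have hx := DFunLike.congr_fun (congrArg Subtype.val hfg) x
    exact Finsupp.single_left_injective (ha x).ne' hx
  · rintro ⟨l, hl⟩
    choose f hf using (Finset.mem_filter.mp hl).2
    obtain rfl : l = Finsupp.equivFunOnFinite.symm fun x => Finsupp.single (f x) (a x) :=
      Finsupp.ext hf
    exact ⟨⟨f, (hmem f).mp hl⟩, rfl⟩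

theorem powerSumProd_map_univ [Fintype ι] (a : ι → ℕ) :
    powerSumProd σ R ((Finset.univ : Finset ι).val.map a) = ∏ x, powerSum σ R (a x) := by
  rw [powerSumProd, Multiset.map_map]
  rfl

theorem coeff_powerSumProd {m : Multiset ℕ} (hm : ∀ k ∈ m, 0 < k) (d : σ →₀ ℕ) :
    coeff d (powerSumProd σ R m) = Nat.card (Placement σ (fun x : m => x.1) d) := by
  rw [← coeff_prod_powerSum R fun x : m => hm _ Multiset.coe_mem, ← powerSumProd_map_univ,
    Multiset.map_univ_coe]

variable {R}

theorem map_support_eq_or_card_support_lt_of_coeff_powerSumProd_ne_zero {m : Multiset ℕ}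
    (hm : ∀ k ∈ m, 0 < k) {d : σ →₀ ℕ} (h : coeff d (powerSumProd σ R m) ≠ 0) :
    d.support.val.map d = m ∨ d.support.card < Multiset.card m := by
  rw [coeff_powerSumProd R hm] at h
  obtain ⟨⟨f⟩, -⟩ := Nat.card_ne_zero.mp fun h0 => h (by rw [h0, Nat.cast_zero])
  have := f.map_support_eq_or_card_support_lt fun x => hm _ Multiset.coe_mem
  rwa [Multiset.map_univ_coe, Multiset.card_coe] at this

variable (σ R) in
theorem exists_coeff_powerSumProd_ne_zero [Infinite σ] [CharZero R] {m : Multiset ℕ}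
    (hm : ∀ k ∈ m, 0 < k) :
    ∃ d : σ →₀ ℕ, d.support.val.map d = m ∧ coeff d (powerSumProd σ R m) ≠ 0 := by
  have hpos (x : m) : 0 < x.1 := hm _ Multiset.coe_mem
  let g : m ↪ σ := (Fintype.equivFin m).toEmbedding.trans
    (Fin.valEmbedding.trans (Infinite.natEmbedding σ))
  refine ⟨∑ x : m, Finsupp.single (g x) x.1, ?_, ?_⟩
  · exact (map_support_sum_single hpos g.injective rfl).trans (Multiset.map_univ_coe m)
  · rw [coeff_powerSumProd R hm, Nat.cast_ne_zero]
    have := finite_placement hpos (∑ x : m, Finsupp.single (g x) x.1)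
    exact Nat.card_ne_zero.mpr ⟨⟨⟨g, rfl⟩⟩, this⟩

/-- Pairing `p_lam` with a monomial whose exponents are the parts of `nu` gives a triangular
matrix: merging parts of `lam` only makes a partition shorter. -/
theorem linearIndependent_powerSumProd {R : Type*} [CommRing R] [NoZeroDivisors R] [CharZero R]
    [Infinite σ] (n : ℕ) :
    LinearIndependent R fun lam : n.Partition => powerSumProd σ R lam.parts := by
  choose d hd hne using fun lam : n.Partition =>
    exists_coeff_powerSumProd_ne_zero σ R fun _ hk => lam.parts_pos hk
  let M : Matrix n.Partition n.Partition R :=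
    fun lam nu => coeff (d nu) (powerSumProd σ R lam.parts)
  have hM : IsRankTriangular (fun lam => OrderDual.toDual (length lam)) M := by
    refine ⟨hne, fun {lam nu} h => ?_⟩
    refine (map_support_eq_or_card_support_lt_of_coeff_powerSumProd_ne_zero
      (fun _ hk => lam.parts_pos hk) h).imp (fun h => ?_) fun h => ?_
    · exact Nat.Partition.ext (h.symm.trans (hd nu))
    · rwa [← Finset.card_val, ← Multiset.card_map (d nu), hd nu] at h
  rw [Fintype.linearIndependent_iff]
  intro a ha
  refine congrFun (hM.vecMul_injective (a₂ := 0) (funext fun nu => ?_))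
  simpa [Matrix.vecMul, dotProduct, M] using congrArg (coeff (d nu)) ha

end PowerSum

section ComponentSizes

open SimpleGraph

variable {V : Type*} [Fintype V]

theorem card_componentSizes (G : SimpleGraph V) :
    Multiset.card (componentSizes G) = Nat.card G.ConnectedComponent := by
  classical
  rw [componentSizes, Multiset.card_map, Finset.card_val, Finset.card_univ,
    Nat.card_eq_fintype_card]

theorem componentSizes_eq_map_univ (G : SimpleGraph V) [Fintype G.ConnectedComponent] :
    componentSizes G =
      (Finset.univ : Finset G.ConnectedComponent).val.map fun c => c.supp.ncard := by
  unfold componentSizes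
  congr!

theorem sum_ncard_supp (G : SimpleGraph V) [Fintype G.ConnectedComponent] :
    ∑ c : G.ConnectedComponent, c.supp.ncard = Fintype.card V := by
  rw [← componentSizes_sum G, componentSizes_eq_map_univ]
  rfl

theorem componentSizes_eq_or_card_lt_of_le {G H : SimpleGraph V} (h : H ≤ G) :
    componentSizes H = componentSizes G ∨
      Multiset.card (componentSizes G) < Multiset.card (componentSizes H) := by
  classical
  let merge : H.ConnectedComponent → G.ConnectedComponent := .map (.ofLE h)
  have hsurj : Function.Surjective merge := ConnectedComponent.surjective_map_ofLE h
  rw [card_componentSizes, card_componentSizes]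
  refine (Nat.card_le_card_of_surjective merge hsurj).lt_or_eq.symm.imp_left fun hcard => ?_
  have hbij : Function.Bijective merge :=
    (Nat.bijective_iff_surjective_and_card merge).mpr ⟨hsurj, hcard.symm⟩
  rw [componentSizes_eq_map_univ, componentSizes_eq_map_univ,
    ← Multiset.map_univ_val_equiv (Equiv.ofBijective merge hbij), Multiset.map_map]
  refine Multiset.map_congr rfl fun c _ => congrArg Set.ncard ?_
  obtain ⟨v, rfl⟩ := c.exists_rep
  ext w
  exact hbij.1.eq_iff.symm

theorem sum_card_edgeSet_toSimpleGraph {W : Type*} [Finite W] (G : SimpleGraph W)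
    [Fintype G.ConnectedComponent] :
    ∑ c : G.ConnectedComponent, Nat.card c.toSimpleGraph.edgeSet = Nat.card G.edgeSet := by
  rw [← Nat.card_sigma]
  refine Nat.card_eq_of_bijective
    (fun e : (c : G.ConnectedComponent) × c.toSimpleGraph.edgeSet =>
      e.1.toSimpleGraph_hom.mapEdgeSet e.2) ⟨?_, ?_⟩
  · rintro ⟨c, ⟨e, he⟩⟩ ⟨c', ⟨e', he'⟩⟩ h
    have h : e.map Subtype.val = e'.map Subtype.val := congrArg Subtype.val h
    obtain rfl : c = c' := by
      induction e with | _ v w =>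
      have hv : v.1 ∈ e'.map Subtype.val := h ▸ Sym2.mem_mk_left v.1 w.1
      obtain ⟨v', -, hv'⟩ := Sym2.mem_map.mp hv
      exact ConnectedComponent.eq_of_common_vertex v.2 (by rw [← hv']; exact v'.2)
    obtain rfl := Sym2.map.injective Subtype.val_injective h
    rfl
  · rintro ⟨e, he⟩
    induction e with | _ v w =>
    exact ⟨⟨G.connectedComponentMk v, ⟨s(⟨v, rfl⟩,
      ⟨w, (ConnectedComponent.connectedComponentMk_eq_of_adj he).symm⟩), he⟩⟩, rfl⟩

theorem card_edgeSet_add_card_componentSizes_eq_sum (G : SimpleGraph V)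
    [Fintype G.ConnectedComponent] :
    Nat.card G.edgeSet + Multiset.card (componentSizes G) =
      ∑ c : G.ConnectedComponent, (Nat.card c.toSimpleGraph.edgeSet + 1) := by
  rw [← sum_card_edgeSet_toSimpleGraph, card_componentSizes, Nat.card_eq_fintype_card,
    Fintype.card_eq_sum_ones, ← Finset.sum_add_distrib]

theorem card_le_card_edgeSet_add_card_componentSizes (G : SimpleGraph V) :
    Fintype.card V ≤ Nat.card G.edgeSet + Multiset.card (componentSizes G) := by
  classical
  rw [← sum_ncard_supp G, card_edgeSet_add_card_componentSizes_eq_sum]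
  exact Finset.sum_le_sum fun c _ => c.connected_toSimpleGraph.card_vert_le_card_edgeSet_add_one

theorem card_edgeSet_add_card_componentSizes {G : SimpleGraph V} (hG : G.IsAcyclic) :
    Nat.card G.edgeSet + Multiset.card (componentSizes G) = Fintype.card V := by
  classical
  rw [← sum_ncard_supp G, card_edgeSet_add_card_componentSizes_eq_sum]
  exact Finset.sum_congr rfl fun c _ =>
    (isTree_iff_connected_and_card.mp (hG.isTree_connectedComponent c)).2

theorem edgeSet_fromEdgeSet_of_subset {W : Type*} {G : SimpleGraph W} {A : Set (Sym2 W)}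
    (hA : A ⊆ G.edgeSet) : (fromEdgeSet A).edgeSet = A := by
  rw [edgeSet_fromEdgeSet, sdiff_eq_left, Set.disjoint_left]
  exact fun e he => G.not_isDiag_of_mem_edgeSet (hA he)

end ComponentSizes

section ChromaticSymmetricFunction

open SimpleGraph MvPowerSeries

variable {V : Type*} {α : Type*}

/-- The edges of `G` that violate properness of the coloring `κ`. -/
def monochromaticEdges [DecidableEq α] (G : SimpleGraph V) [Fintype G.edgeSet] (κ : V → α) :
    Finset (Sym2 V) :=
  {e ∈ G.edgeFinset | (e.map κ).IsDiag}

theorem monochromaticEdges_eq_empty_iff [DecidableEq α] {G : SimpleGraph V} [Fintype G.edgeSet]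
    {κ : V → α} : monochromaticEdges G κ = ∅ ↔ ∀ v w, G.Adj v w → κ v ≠ κ w := by
  simp [monochromaticEdges, Finset.filter_eq_empty_iff, Sym2.forall]

theorem subset_monochromaticEdges_iff [DecidableEq α] {G : SimpleGraph V} [Fintype G.edgeSet]
    {κ : V → α} {A : Finset (Sym2 V)} (hA : A ⊆ G.edgeFinset) :
    A ⊆ monochromaticEdges G κ ↔ ∀ v w, (fromEdgeSet (A : Set (Sym2 V))).Adj v w → κ v = κ w := by
  have hadj {v w : V} (h : s(v, w) ∈ A) : v ≠ w := G.ne_of_adj (mem_edgeFinset.mp (hA h))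
  simp only [monochromaticEdges, Finset.subset_iff, Finset.mem_filter, Sym2.forall, Sym2.map_mk,
    Sym2.mk_isDiag_iff, fromEdgeSet_adj, Finset.mem_coe, and_imp]
  exact forall₂_congr fun v w => ⟨fun h hvw _ => (h hvw).2, fun h hvw => ⟨hA hvw, h hvw (hadj hvw)⟩⟩

theorem sum_powerset_subset_neg_one_pow_card {R : Type*} [CommRing R] [DecidableEq α]
    {S T : Finset α} (hST : S ⊆ T) :
    ∑ A ∈ T.powerset with A ⊆ S, (-1 : R) ^ A.card = if S = ∅ then 1 else 0 := by
  have hfilter : {A ∈ T.powerset | A ⊆ S} = S.powerset := by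
    ext A
    simp only [Finset.mem_filter, Finset.mem_powerset, and_iff_right_iff_imp]
    exact fun hA => hA.trans hST
  rw [hfilter]
  exact_mod_cast congrArg (Int.cast : ℤ → R) Finset.sum_powerset_neg_one_pow_card

variable [Fintype V]

theorem coeff_csf (G : SimpleGraph V) (d : ℕ+ →₀ ℕ) :
    coeff d (csf G) = Nat.card
      {κ : Placement ℕ+ (fun _ : V => 1) d // ∀ v w, G.Adj v w → κ.1 v ≠ κ.1 w} := by
  refine congrArg (Nat.cast : ℕ → ℚ) (Nat.card_congr ?_)
  exact
    { toFun := fun κ => ⟨⟨κ.1, κ.2⟩, fun _ _ h => κ.1.valid h⟩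
      invFun := fun κ => ⟨⟨κ.1.1, fun h => κ.2 _ _ h⟩, κ.1.2⟩
      left_inv := fun _ => rfl
      right_inv := fun _ => rfl }

theorem sum_single_connectedComponentMk (H : SimpleGraph V) [Fintype H.ConnectedComponent]
    (g : H.ConnectedComponent → α) :
    ∑ v, Finsupp.single (g (H.connectedComponentMk v)) 1 =
      ∑ c : H.ConnectedComponent, Finsupp.single (g c) c.supp.ncard := by
  classical
  rw [← Finset.sum_fiberwise _ H.connectedComponentMk]
  refine Finset.sum_congr rfl fun c _ => ?_
  have hsupp : (({v | H.connectedComponentMk v = c} : Finset V) : Set V) = c.supp := by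
    ext v
    simp
  calc ∑ v with H.connectedComponentMk v = c, Finsupp.single (g (H.connectedComponentMk v)) 1
      = ∑ v with H.connectedComponentMk v = c, Finsupp.single (g c) 1 :=
        Finset.sum_congr rfl fun v hv => by rw [(Finset.mem_filter.mp hv).2]
    _ = Finsupp.single (g c) c.supp.ncard := by
        rw [Finset.sum_const, Finsupp.smul_single, smul_eq_mul, mul_one, ← Set.ncard_coe_finset,
          hsupp]

theorem coeff_powerSumProd_componentSizes {R : Type*} [CommSemiring R] (H : SimpleGraph V)
    (d : α →₀ ℕ) :
    coeff d (powerSumProd α R (componentSizes H)) = Nat.card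
      {κ : Placement α (fun _ : V => 1) d // ∀ v w, H.Adj v w → κ.1 v = κ.1 w} := by
  classical
  have hconst (κ : V → α) (hκ : ∀ v w, H.Adj v w → κ v = κ w) (v w : V) (p : H.Walk v w) :
      κ v = κ w := by
    induction p with
    | nil => rfl
    | cons h _ ih => exact (hκ _ _ h).trans ih
  rw [componentSizes_eq_map_univ, powerSumProd_map_univ, coeff_prod_powerSum R fun c =>
    (Set.ncard_pos c.supp.toFinite).mpr c.nonempty_supp]
  refine congrArg _ (Nat.card_congr ?_)
  exact
    { toFun := fun g => ⟨⟨fun v => g.1 (H.connectedComponentMk v),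
          (sum_single_connectedComponentMk H g.1).trans g.2⟩,
        fun v w h => congrArg g.1 (ConnectedComponent.connectedComponentMk_eq_of_adj h)⟩
      invFun := fun κ => ⟨ConnectedComponent.lift κ.1.1 fun v w p _ => hconst _ κ.2 v w p,
        (sum_single_connectedComponentMk H _).symm.trans κ.1.2⟩
      left_inv := fun g => Subtype.ext (funext fun c => c.ind fun _ => rfl)
      right_inv := fun κ => rfl }

/-- Stanley's expansion in power sums: inclusion-exclusion over the sets of edges required to be
monochromatic. -/
theorem csf_eq_sum_powerset (G : SimpleGraph V) [Fintype G.edgeSet] :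
    csf G = ∑ A ∈ G.edgeFinset.powerset, (-1 : ℚ) ^ A.card •
      powerSumProd ℕ+ ℚ (componentSizes (fromEdgeSet (A : Set (Sym2 V)))) := by
  classical
  ext d
  have := finite_placement (fun _ : V => one_pos) d
  let _ : Fintype (Placement ℕ+ (fun _ : V => 1) d) := .ofFinite _
  have hproper : coeff d (csf G) = ∑ κ : Placement ℕ+ (fun _ : V => 1) d,
      if monochromaticEdges G κ.1 = ∅ then (1 : ℚ) else 0 := by
    simp only [coeff_csf, monochromaticEdges_eq_empty_iff, Nat.card_eq_fintype_card,
      Fintype.card_subtype, Finset.sum_boole]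
  have hmono (A) (hA : A ∈ G.edgeFinset.powerset) :
      coeff d (powerSumProd ℕ+ ℚ (componentSizes (fromEdgeSet (A : Set (Sym2 V))))) =
        ∑ κ : Placement ℕ+ (fun _ : V => 1) d,
          if A ⊆ monochromaticEdges G κ.1 then (1 : ℚ) else 0 := by
    simp only [coeff_powerSumProd_componentSizes,
      subset_monochromaticEdges_iff (Finset.mem_powerset.mp hA), Nat.card_eq_fintype_card,
      Fintype.card_subtype, Finset.sum_boole]
  simp only [hproper, map_sum, map_smul, smul_eq_mul]
  calc ∑ κ : Placement ℕ+ (fun _ : V => 1) d,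
          (if monochromaticEdges G κ.1 = ∅ then (1 : ℚ) else 0)
      = ∑ κ : Placement ℕ+ (fun _ : V => 1) d, ∑ A ∈ G.edgeFinset.powerset,
          if A ⊆ monochromaticEdges G κ.1 then (-1 : ℚ) ^ A.card else 0 :=
        Finset.sum_congr rfl fun κ _ => by
          rw [← Finset.sum_filter,
            sum_powerset_subset_neg_one_pow_card (S := monochromaticEdges G κ.1)
              (Finset.filter_subset _ _)]
    _ = ∑ A ∈ G.edgeFinset.powerset, (-1 : ℚ) ^ A.card *
          coeff d (powerSumProd ℕ+ ℚ (componentSizes (fromEdgeSet (A : Set (Sym2 V))))) := by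
        rw [Finset.sum_comm]
        refine Finset.sum_congr rfl fun A hA => ?_
        simp only [hmono A hA, Finset.mul_sum, mul_ite, mul_one, mul_zero]

end ChromaticSymmetricFunction

section UPolynomial

open SimpleGraph Polynomial

theorem prod_X_pow_count {σ R : Type*} [CommSemiring R] [DecidableEq σ] {m : Multiset σ}
    {s : Finset σ} (hs : ∀ i ∈ m, i ∈ s) :
    ∏ i ∈ s, (MvPolynomial.X i : MvPolynomial σ R) ^ m.count i =
      MvPolynomial.monomial (Multiset.toFinsupp m) 1 := by
  rw [← MvPolynomial.prod_X_pow_eq_monomial, Multiset.toFinsupp_support]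
  refine (Finset.prod_subset (fun i hi => hs i (Multiset.mem_toFinset.mp hi)) fun i _ hi => ?_).symm
  rw [Multiset.mem_toFinset, ← Multiset.count_eq_zero] at hi
  rw [hi, pow_zero]

variable {V : Type*} [Fintype V]

open Classical in
/-- The sets `A ⊆ E(G)` for which the components of `(V, A)` have the sizes listed in `m`: the
terms of `U_G` that contribute to the coefficient of `∏_{i ∈ m} x_i`. -/
def edgeSubsets (G : SimpleGraph V) (m : Multiset ℕ) : Finset (Finset (Sym2 V)) :=
  {A ∈ G.edgeFinset.powerset | componentSizes (fromEdgeSet (A : Set (Sym2 V))) = m}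

theorem mem_edgeSubsets {G : SimpleGraph V} {m : Multiset ℕ} {A : Finset (Sym2 V)} :
    A ∈ edgeSubsets G m ↔
      (A : Set (Sym2 V)) ⊆ G.edgeSet ∧ componentSizes (fromEdgeSet (A : Set (Sym2 V))) = m := by
  classical
  rw [edgeSubsets, Finset.mem_filter, Finset.mem_powerset, ← Finset.coe_subset, coe_edgeFinset]

theorem card_le_card_add_card_of_mem_edgeSubsets {G : SimpleGraph V} {m : Multiset ℕ}
    {A : Finset (Sym2 V)} (hA : A ∈ edgeSubsets G m) :
    Fintype.card V ≤ A.card + Multiset.card m := by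
  obtain ⟨hAG, rfl⟩ := mem_edgeSubsets.mp hA
  have := card_le_card_edgeSet_add_card_componentSizes (fromEdgeSet (A : Set (Sym2 V)))
  rwa [edgeSet_fromEdgeSet_of_subset hAG, Nat.card_coe_set_eq, Set.ncard_coe_finset] at this

theorem card_add_card_of_mem_edgeSubsets {G : SimpleGraph V} (hG : G.IsAcyclic) {m : Multiset ℕ}
    {A : Finset (Sym2 V)} (hA : A ∈ edgeSubsets G m) :
    A.card + Multiset.card m = Fintype.card V := by
  obtain ⟨hAG, rfl⟩ := mem_edgeSubsets.mp hA
  have := card_edgeSet_add_card_componentSizes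
    (hG.anti (G.fromEdgeSet_le.mpr (Set.sdiff_subset.trans hAG)))
  rwa [edgeSet_fromEdgeSet_of_subset hAG, Nat.card_coe_set_eq, Set.ncard_coe_finset] at this

theorem edgeSubsets_componentSizes {G : SimpleGraph V} [Fintype G.edgeSet] (hG : G.IsAcyclic) :
    edgeSubsets G (componentSizes G) = {G.edgeFinset} := by
  refine Finset.eq_singleton_iff_unique_mem.mpr ⟨mem_edgeSubsets.mpr ?_, fun A hA => ?_⟩
  · rw [coe_edgeFinset, fromEdgeSet_edgeSet]
    exact ⟨subset_rfl, rfl⟩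
  · have hAG : A ⊆ G.edgeFinset := by
      rw [← Finset.coe_subset, coe_edgeFinset]
      exact (mem_edgeSubsets.mp hA).1
    refine Finset.eq_of_subset_of_card_le hAG (Nat.le_of_add_le_add_right (b :=
      Multiset.card (componentSizes G)) (le_of_eq ?_))
    rw [card_add_card_of_mem_edgeSubsets hG hA, ← card_edgeSet_add_card_componentSizes hG,
      Nat.card_eq_fintype_card, edgeFinset_card]

variable {n : ℕ}

theorem part_eq_iff {G : SimpleGraph V} {hV : Fintype.card V = n} {lam : n.Partition} :
    part G hV = lam ↔ componentSizes G = lam.parts :=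
  Nat.Partition.ext_iff

/-- Deleting edges refines the partition into components. -/
theorem edgeSubsets_eq_empty {G : SimpleGraph V} (hV : Fintype.card V = n) {lam : n.Partition}
    (hlam : length lam ≤ length (part G hV)) (hne : lam ≠ part G hV) :
    edgeSubsets G lam.parts = ∅ := by
  refine Finset.eq_empty_of_forall_notMem fun A hA => ?_
  obtain ⟨hAG, hsizes⟩ := mem_edgeSubsets.mp hA
  have hle := G.fromEdgeSet_le.mpr (Set.sdiff_subset.trans hAG)
  rcases componentSizes_eq_or_card_lt_of_le hle with h | h
  · exact hne (part_eq_iff.mpr (h.symm.trans hsizes)).symm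
  · rw [hsizes] at h
    exact hlam.not_gt h

theorem uCoeff_eq_sum (lam : n.Partition) (G : SimpleGraph V) :
    uCoeff lam G = ∑ A ∈ edgeSubsets G lam.parts,
      (X - 1 : ℚ[X]) ^ (A.card - (Fintype.card V - length lam)) := by
  classical
  simp only [uCoeff, uPoly, MvPolynomial.coeff_sum]
  rw [edgeSubsets, Finset.sum_filter]
  refine Finset.sum_congr rfl fun A _ => ?_
  rw [prod_X_pow_count fun i hi => ?_, MvPolynomial.coeff_C_mul, MvPolynomial.coeff_monomial]
  · simp only [EmbeddingLike.apply_eq_iff_eq, mul_ite, mul_one, mul_zero]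
    exact if_ctx_congr Iff.rfl (fun h => by rw [h, length]) fun _ => rfl
  · rw [Finset.mem_Icc, ← componentSizes_sum (fromEdgeSet (A : Set (Sym2 V)))]
    exact ⟨componentSizes_pos _ hi, Multiset.le_sum_of_mem hi⟩

/-- The coefficients of `U_G` at `y = 0`.  For a forest they are all of `U_G`, and for every graph
they determine `X_G`. -/
def uVector (G : SimpleGraph V) (lam : n.Partition) : ℚ :=
  (uCoeff lam G).eval 0

theorem uVector_eq_sum (G : SimpleGraph V) (lam : n.Partition) :
    uVector G lam = ∑ A ∈ edgeSubsets G lam.parts,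
      (-1 : ℚ) ^ (A.card - (Fintype.card V - length lam)) := by
  simp [uVector, uCoeff_eq_sum, eval_finsetSum]

theorem uCoeff_eq_C_uVector {F : SimpleGraph V} (hF : F.IsAcyclic) (lam : n.Partition) :
    uCoeff lam F = C (uVector F lam) := by
  have hexp (A) (hA : A ∈ edgeSubsets F lam.parts) :
      A.card - (Fintype.card V - length lam) = 0 := by
    have := card_add_card_of_mem_edgeSubsets hF hA
    rw [← length] at this
    lia
  rw [uCoeff_eq_sum, uVector_eq_sum, map_sum]
  exact Finset.sum_congr rfl fun A hA => by rw [hexp A hA, pow_zero, pow_zero, C_1]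

theorem eq_part_or_length_lt_of_uVector_ne_zero {G : SimpleGraph V} (hV : Fintype.card V = n)
    {lam : n.Partition} (h : uVector G lam ≠ 0) :
    lam = part G hV ∨ length (part G hV) < length lam := by
  by_contra! hlam
  exact h (by rw [uVector_eq_sum, edgeSubsets_eq_empty hV hlam.2 hlam.1, Finset.sum_empty])

theorem uVector_part {F : SimpleGraph V} (hF : F.IsAcyclic) (hV : Fintype.card V = n) :
    uVector F (part F hV) = 1 := by
  classical
  have hexp : F.edgeFinset.card - (Fintype.card V - length (part F hV)) = 0 := by
    have := card_edgeSet_add_card_componentSizes hF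
    rw [Nat.card_eq_fintype_card, ← edgeFinset_card] at this
    change _ - (_ - Multiset.card (componentSizes F)) = 0
    lia
  rw [uVector_eq_sum, show (part F hV).parts = componentSizes F from rfl,
    edgeSubsets_componentSizes hF, Finset.sum_singleton, hexp, pow_zero]

theorem uVector_eq_single_of_length_le {F : SimpleGraph V} (hF : F.IsAcyclic)
    (hV : Fintype.card V = n) {lam : n.Partition} (hlam : length lam ≤ length (part F hV)) :
    uVector F lam = (Pi.single (part F hV) 1 : n.Partition → ℚ) lam := by
  rcases eq_or_ne lam (part F hV) with rfl | hne
  · rw [uVector_part hF, Pi.single_eq_same]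
  · rw [Pi.single_eq_of_ne hne]
    by_contra h
    exact (eq_part_or_length_lt_of_uVector_ne_zero hV h).elim hne hlam.not_gt

variable (n) in
/-- The substitution `x_lam ↦ (-1) ^ (n - ℓ(lam)) p_lam`, which takes `U_G(x, 0)` to `X_G` for every
graph `G` on `n` vertices (Noble and Welsh). -/
def powerSumSubst : (n.Partition → ℚ) →ₗ[ℚ] MvPowerSeries ℕ+ ℚ :=
  Fintype.linearCombination ℚ fun lam =>
    (-1 : ℚˣ) ^ (n - length lam) • powerSumProd ℕ+ ℚ lam.parts

theorem powerSumSubst_injective : Function.Injective (powerSumSubst n) :=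
  linearIndependent_iff_injective_fintypeLinearCombination.mp
    ((linearIndependent_powerSumProd n).units_smul fun lam => (-1) ^ (n - length lam))

theorem powerSumSubst_uVector (hV : Fintype.card V = n) (G : SimpleGraph V) :
    powerSumSubst n (uVector G) = csf G := by
  classical
  have hfiber (lam : n.Partition) :
      uVector G lam • (-1 : ℚˣ) ^ (n - length lam) • powerSumProd ℕ+ ℚ lam.parts =
        ∑ A ∈ edgeSubsets G lam.parts, (-1 : ℚ) ^ A.card •
          powerSumProd ℕ+ ℚ (componentSizes (fromEdgeSet (A : Set (Sym2 V)))) := by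
    rw [uVector_eq_sum, Finset.sum_smul]
    refine Finset.sum_congr rfl fun A hA => ?_
    have hexp : A.card - (n - length lam) + (n - length lam) = A.card :=
      Nat.sub_add_cancel (Nat.sub_le_of_le_add
        (hV.ge.trans (card_le_card_add_card_of_mem_edgeSubsets hA)))
    rw [(mem_edgeSubsets.mp hA).2, hV, Units.smul_def, smul_smul, Units.val_pow_eq_pow_val,
      Units.val_neg, Units.val_one, ← pow_add, hexp]
  rw [powerSumSubst, Fintype.linearCombination_apply, Finset.sum_congr rfl fun lam _ => hfiber lam,
    csf_eq_sum_powerset, ← Finset.sum_fiberwise _ fun A : Finset (Sym2 V) =>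
      part (fromEdgeSet (A : Set (Sym2 V))) hV]
  simp only [part_eq_iff, edgeSubsets]

theorem uVector_eq_of_csf_eq {W : Type*} [Fintype W] {G : SimpleGraph V} {H : SimpleGraph W}
    (hV : Fintype.card V = n) (hW : Fintype.card W = n) (h : csf G = csf H) :
    (uVector G : n.Partition → ℚ) = uVector H :=
  powerSumSubst_injective (by rw [powerSumSubst_uVector hV, powerSumSubst_uVector hW, h])

theorem part_eq_of_csf_eq {W : Type*} [Fintype W] {F : SimpleGraph V} {F' : SimpleGraph W}
    (hF : F.IsAcyclic) (hF' : F'.IsAcyclic) (hV : Fintype.card V = n) (hW : Fintype.card W = n)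
    (h : csf F = csf F') : part F hV = part F' hW := by
  have hu := uVector_eq_of_csf_eq hV hW h
  have hne : uVector F' (part F hV) ≠ 0 := by rw [← hu, uVector_part hF]; exact one_ne_zero
  have hne' : uVector F (part F' hW) ≠ 0 := by rw [hu, uVector_part hF']; exact one_ne_zero
  refine (eq_part_or_length_lt_of_uVector_ne_zero hW hne).elim id fun hlt => ?_
  exact (eq_part_or_length_lt_of_uVector_ne_zero hV hne').elim Eq.symm fun hlt' =>
    absurd hlt' hlt.asymm

end UPolynomial

section Expansion

open Matrix

theorem eq_of_forall_natCast_lt_iff {k l : ℕ∞} (h : ∀ j : ℕ, (j : ℕ∞) < k ↔ (j : ℕ∞) < l) :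
    k = l := by
  have hle {k l : ℕ∞} (h : ∀ j : ℕ, (j : ℕ∞) < k → (j : ℕ∞) < l) : k ≤ l := by
    by_contra! hlk
    lift l to ℕ using hlk.ne_top
    exact lt_irrefl _ (h l hlk)
  exact le_antisymm (hle fun j => (h j).mp) (hle fun j => (h j).mpr)

theorem existsUnique_forall_iff_natCast_lt {P : ℕ → Prop} (hP : Antitone P) :
    ∃! k : ℕ∞, ∀ j : ℕ, P j ↔ (j : ℕ∞) < k := by
  have hsup (j : ℕ) : P j ↔ (j : ℕ∞) < ⨆ (i : ℕ) (_ : P i), ((i + 1 : ℕ) : ℕ∞) := by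
    simp only [lt_iSup_iff, Nat.cast_lt, Nat.lt_succ_iff, exists_prop]
    exact ⟨fun hj => ⟨j, hj, le_rfl⟩, fun ⟨_, hi, hji⟩ => hP hji hi⟩
  exact ⟨_, hsup, fun k hk => eq_of_forall_natCast_lt_iff fun j => (hk j).symm.trans (hsup j)⟩

theorem forall_iff_natCast_lt_iff {P : ℕ → Prop} (hP : Antitone P) (hP0 : P 0) {k : ℕ∞} :
    (∀ j : ℕ, P j ↔ (j : ℕ∞) < k) ↔
      (∃ j : ℕ, k = ((j + 1 : ℕ) : ℕ∞) ∧ P j ∧ ¬P (j + 1)) ∨ (k = ⊤ ∧ ∀ j, P j) := by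
  constructor
  · intro h
    rcases k with _ | _ | j
    · exact .inr ⟨rfl, fun j => (h j).mpr (ENat.natCast_lt_top j)⟩
    · exact absurd ((h 0).mp hP0) (lt_irrefl _)
    · refine .inl ⟨j, rfl, (h j).mpr (Nat.cast_lt.mpr j.lt_succ_self), fun hj => ?_⟩
      exact lt_irrefl _ ((h (j + 1)).mp hj)
  · rintro (⟨j, rfl, hj, hj'⟩ | ⟨rfl, h⟩) i
    · rw [Nat.cast_lt, Nat.lt_succ_iff]
      exact ⟨fun hi => not_lt.mp fun hji => hj' (hP hji hi), fun hij => hP hij hj⟩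
    · exact iff_of_true (h i) (ENat.natCast_lt_top i)

namespace ChromaticBasis

variable {n : ℕ} {V : Type*} [Fintype V]

/-- The matrix whose rows are the vectors `uVector` of the graphs in the basis: expanding `X_G` in
the basis means solving `c ᵥ* B.uMatrix = uVector G`. -/
def uMatrix (B : ChromaticBasis n) : Matrix n.Partition n.Partition ℚ :=
  of fun lam => uVector (B.graph lam)

variable {B : ChromaticBasis n}

theorem isExpansion_iff_vecMul_uMatrix (hV : Fintype.card V = n) {G : SimpleGraph V}
    {c : n.Partition → ℚ} : B.IsExpansion G c ↔ c ᵥ* B.uMatrix = uVector G := by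
  have hsum : ∑ lam, c lam • csf (B.graph lam) = powerSumSubst n (c ᵥ* B.uMatrix) := by
    rw [vecMul_eq_sum, map_sum]
    refine Finset.sum_congr rfl fun lam _ => ?_
    rw [map_smul, ← powerSumSubst_uVector (Fintype.card_fin n)]
    rfl
  rw [IsExpansion, hsum, ← powerSumSubst_uVector hV, powerSumSubst_injective.eq_iff, eq_comm]

namespace IsForestBasis

theorem uMatrix_diag (hB : B.IsForestBasis) (lam : n.Partition) : B.uMatrix lam lam = 1 := by
  have := uVector_part (hB lam) (Fintype.card_fin n)
  rwa [B.part_graph] at this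

theorem isRankTriangular_uMatrix (hB : B.IsForestBasis) : IsRankTriangular length B.uMatrix where
  diag_ne_zero lam := by rw [hB.uMatrix_diag]; exact one_ne_zero
  eq_or_lt {lam nu} h := by
    have := eq_part_or_length_lt_of_uVector_ne_zero (Fintype.card_fin n) h
    rw [B.part_graph] at this
    exact this.imp_left Eq.symm

theorem isExpansion_iff_eq_coeff (hB : B.IsForestBasis) (hV : Fintype.card V = n)
    {G : SimpleGraph V} {c : n.Partition → ℚ} : B.IsExpansion G c ↔ c = B.coeff G := by
  obtain ⟨c₀, hc₀⟩ := hB.isRankTriangular_uMatrix.vecMul_surjective (uVector G)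
  have hex : ∃ c, B.IsExpansion G c := ⟨c₀, (isExpansion_iff_vecMul_uMatrix hV).mpr hc₀⟩
  have hcoeff : B.IsExpansion G (B.coeff G) := by
    rw [show B.coeff G = hex.choose from funext fun lam => dif_pos hex]
    exact hex.choose_spec
  refine ⟨fun hc => hB.isRankTriangular_uMatrix.vecMul_injective ?_, fun hc => hc ▸ hcoeff⟩
  exact ((isExpansion_iff_vecMul_uMatrix hV).mp hc).trans
    ((isExpansion_iff_vecMul_uMatrix hV).mp hcoeff).symm

theorem isExpansion_graph_iff (hB : B.IsForestBasis) {mu : n.Partition} {c : n.Partition → ℚ} :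
    B.IsExpansion (B.graph mu) c ↔ c = Pi.single mu 1 := by
  have hrow : uVector (B.graph mu) = Pi.single mu 1 ᵥ* B.uMatrix :=
    (single_one_vecMul mu B.uMatrix).symm
  rw [isExpansion_iff_vecMul_uMatrix (Fintype.card_fin n), hrow]
  exact hB.isRankTriangular_uMatrix.vecMul_injective.eq_iff

theorem truncation_eq_iff (hB : B.IsForestBasis) (hV : Fintype.card V = n) {G : SimpleGraph V}
    {j : ℕ} : B.truncation G hV j = csf (B.graph (part G hV)) ↔
      ∀ lam, length lam ≤ length (part G hV) + j →
        B.coeff G lam = (Pi.single (part G hV) 1 : n.Partition → ℚ) lam := by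
  have htrunc : B.truncation G hV j = ∑ lam,
      (if length lam ≤ length (part G hV) + j then B.coeff G lam else 0) • csf (B.graph lam) := by
    simp only [truncation, Finset.sum_filter, ite_smul, zero_smul]
  rw [htrunc, eq_comm, ← IsExpansion, hB.isExpansion_graph_iff, funext_iff]
  refine forall_congr' fun lam => ?_
  split_ifs with hlam
  · exact ⟨fun h _ => h, fun h => h hlam⟩
  · have hne : lam ≠ part G hV := fun h => hlam (h ▸ Nat.le_add_right _ _)
    rw [Pi.single_eq_of_ne hne]
    exact iff_of_true rfl fun h => absurd h hlam

theorem coeff_sub_single_vecMul (hB : B.IsForestBasis) (hV : Fintype.card V = n)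
    (G : SimpleGraph V) (mu : n.Partition) :
    (B.coeff G - Pi.single mu 1) ᵥ* B.uMatrix = uVector G - uVector (B.graph mu) := by
  rw [sub_vecMul, (isExpansion_iff_vecMul_uMatrix hV).mp ((hB.isExpansion_iff_eq_coeff hV).mpr rfl),
    single_one_vecMul]
  rfl

/-- Up to the first length at which the expansion of `X_G` departs from `X_{G_mu}`, the triangular
system is diagonal. -/
theorem coeff_sub_single_eq (hB : B.IsForestBasis) (hV : Fintype.card V = n) {G : SimpleGraph V}
    {mu lam : n.Partition} (h : ∀ nu, length nu < length lam →
      B.coeff G nu = (Pi.single mu 1 : n.Partition → ℚ) nu) :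
    B.coeff G lam - (Pi.single mu 1 : n.Partition → ℚ) lam =
      uVector G lam - uVector (B.graph mu) lam := by
  have := hB.isRankTriangular_uMatrix.vecMul_apply (a := B.coeff G - Pi.single mu 1)
    fun nu hnu => sub_eq_zero.mpr (h nu hnu)
  rw [hB.coeff_sub_single_vecMul hV, hB.uMatrix_diag, mul_one] at this
  exact this.symm

theorem uVector_graph_eq_single (hB : B.IsForestBasis) {mu lam : n.Partition}
    (hlam : length lam ≤ length mu) :
    uVector (B.graph mu) lam = (Pi.single mu 1 : n.Partition → ℚ) lam := by
  have := uVector_eq_single_of_length_le (hB mu) (Fintype.card_fin n) (lam := lam)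
  rw [B.part_graph] at this
  exact this hlam

theorem coeff_eq_single_of_length_le (hB : B.IsForestBasis) (hV : Fintype.card V = n)
    {F : SimpleGraph V} (hF : F.IsAcyclic) {lam : n.Partition}
    (hlam : length lam ≤ length (part F hV)) :
    B.coeff F lam = (Pi.single (part F hV) 1 : n.Partition → ℚ) lam := by
  refine sub_eq_zero.mp (hB.isRankTriangular_uMatrix.eq_zero_of_vecMul_eq_zero
    (a := B.coeff F - Pi.single (part F hV) 1) (fun nu hnu => ?_) hlam)
  rw [hB.coeff_sub_single_vecMul hV, Pi.sub_apply, uVector_eq_single_of_length_le hF hV hnu,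
    hB.uVector_graph_eq_single hnu, sub_self]

theorem truncation_zero (hB : B.IsForestBasis) (hV : Fintype.card V = n) {F : SimpleGraph V}
    (hF : F.IsAcyclic) : B.truncation F hV 0 = csf (B.graph (part F hV)) :=
  (hB.truncation_eq_iff hV).mpr fun _ hlam => hB.coeff_eq_single_of_length_le hV hF hlam

theorem antitone_truncation_eq (hB : B.IsForestBasis) (hV : Fintype.card V = n)
    (G : SimpleGraph V) :
    Antitone fun j => B.truncation G hV j = csf (B.graph (part G hV)) := by
  intro i j hij h
  rw [hB.truncation_eq_iff] at h ⊢
  exact fun lam hlam => h lam (by lia)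

theorem isCornerNumber_iff (hB : B.IsForestBasis) (hV : Fintype.card V = n) {F : SimpleGraph V}
    (hF : F.IsAcyclic) {k : ℕ∞} : B.IsCornerNumber F hV k ↔
      ∀ j : ℕ, B.truncation F hV j = csf (B.graph (part F hV)) ↔ (j : ℕ∞) < k :=
  (forall_iff_natCast_lt_iff (hB.antitone_truncation_eq hV F) (hB.truncation_zero hV hF)).symm

theorem existsUnique_isCornerNumber (hB : B.IsForestBasis) (hV : Fintype.card V = n)
    {F : SimpleGraph V} (hF : F.IsAcyclic) : ∃! k : ℕ∞, B.IsCornerNumber F hV k := by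
  simp only [hB.isCornerNumber_iff hV hF]
  exact existsUnique_forall_iff_natCast_lt (hB.antitone_truncation_eq hV F)

theorem coeff_eq_single_of_isCornerNumber (hB : B.IsForestBasis) (hV : Fintype.card V = n)
    {F : SimpleGraph V} (hF : F.IsAcyclic) {k : ℕ∞} (hk : B.IsCornerNumber F hV k)
    {lam : n.Partition} (hlam : (length lam : ℕ∞) < length (part F hV) + k) :
    B.coeff F lam = (Pi.single (part F hV) 1 : n.Partition → ℚ) lam := by
  rcases le_total (length lam) (length (part F hV)) with hle | hle
  · exact hB.coeff_eq_single_of_length_le hV hF hle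
  · obtain ⟨j, hj⟩ := Nat.exists_eq_add_of_le hle
    rw [hj, Nat.cast_add, ENat.add_lt_add_iff_left (ENat.natCast_ne_top _)] at hlam
    exact (hB.truncation_eq_iff hV).mp (((hB.isCornerNumber_iff hV hF).mp hk j).mpr hlam) lam hj.le

theorem coeff_eq_uVector_sub_uVector (hB : B.IsForestBasis) (hV : Fintype.card V = n)
    {F : SimpleGraph V} (hF : F.IsAcyclic) {k : ℕ∞} (hk : B.IsCornerNumber F hV k)
    {lam : n.Partition} (hne : lam ≠ part F hV)
    (hlam : (length lam : ℕ∞) ≤ length (part F hV) + k) :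
    B.coeff F lam = uVector F lam - uVector (B.graph (part F hV)) lam := by
  rw [← hB.coeff_sub_single_eq hV fun nu hnu => hB.coeff_eq_single_of_isCornerNumber hV hF hk
    ((Nat.cast_lt.mpr hnu).trans_le hlam), Pi.single_eq_of_ne hne, sub_zero]

theorem uVector_eq_of_csf_mem_toSet (hB : B.IsForestBasis) (hV : Fintype.card V = n)
    {F : SimpleGraph V} (hF : F.IsAcyclic) (h : csf F ∈ B.toSet) :
    (uVector F : n.Partition → ℚ) = uVector (B.graph (part F hV)) := by
  obtain ⟨mu, hmu⟩ := h
  have hpart : part F hV = mu :=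
    (part_eq_of_csf_eq hF (hB mu) hV (Fintype.card_fin n) hmu.symm).trans (B.part_graph mu)
  rw [hpart]
  exact uVector_eq_of_csf_eq hV (Fintype.card_fin n) hmu.symm

end IsForestBasis

end ChromaticBasis

end Expansion

end

end ForestCSF

theorem mainTheorem2 {n : ℕ} {V₁ V₂ : Type*} [Fintype V₁] [Fintype V₂]
    (hV₁ : Fintype.card V₁ = n) (hV₂ : Fintype.card V₂ = n)
    (F₁ : SimpleGraph V₁) (F₂ : SimpleGraph V₂)
    (hF₁ : F₁.IsAcyclic) (hF₂ : F₂.IsAcyclic)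
    (μ : n.Partition)
    (hμ₁ : ForestCSF.part F₁ hV₁ = μ) (hμ₂ : ForestCSF.part F₂ hV₂ = μ)
    (B : ForestCSF.ChromaticBasis n) (hB : B.IsForestBasis)
    (hF₂B : ForestCSF.csf F₂ ∈ B.toSet) :
    (∀ c : n.Partition → ℚ, B.IsExpansion F₁ c ↔ c = B.coeff F₁) ∧
    (∃! k : ℕ∞, B.IsCornerNumber F₁ hV₁ k) ∧
    (∀ k : ℕ∞, B.IsCornerNumber F₁ hV₁ k →
      ∀ lam : n.Partition, lam ≠ μ →
        (ForestCSF.length lam : ℕ∞) ≤ (ForestCSF.length μ : ℕ∞) + k →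
        Polynomial.C (B.coeff F₁ lam) =
          ForestCSF.uCoeff lam F₁ - ForestCSF.uCoeff lam F₂) ∧
    B.coeff F₁ μ = 1 ∧
    ForestCSF.uCoeff μ F₁ - ForestCSF.uCoeff μ F₂ = 0 := by
  have hF₂μ : ForestCSF.uVector F₂ = ForestCSF.uVector (B.graph μ) :=
    hμ₂ ▸ hB.uVector_eq_of_csf_mem_toSet hV₂ hF₂ hF₂B
  have hu₁ : ForestCSF.uVector F₁ μ = 1 := hμ₁ ▸ ForestCSF.uVector_part hF₁ hV₁
  have hu₂ : ForestCSF.uVector F₂ μ = 1 := hμ₂ ▸ ForestCSF.uVector_part hF₂ hV₂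
  simp only [ForestCSF.uCoeff_eq_C_uVector hF₁, ForestCSF.uCoeff_eq_C_uVector hF₂,
    ← Polynomial.C_sub, hu₁, hu₂, sub_self, and_true]
  subst hμ₁
  refine ⟨fun c => hB.isExpansion_iff_eq_coeff hV₁, hB.existsUnique_isCornerNumber hV₁ hF₁,
    fun k hk lam hne hlam => ?_, ?_⟩
  · rw [hB.coeff_eq_uVector_sub_uVector hV₁ hF₁ hk hne hlam, hF₂μ]
  · rw [hB.coeff_eq_single_of_length_le hV₁ hF₁ le_rfl, Pi.single_eq_same]
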